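/- For a complex square matrix $M$ let $\|M\|_2=\sqrt{\operatorname{Tr}(M^*M)}$ be its Frobenius norm, where $\operatorname{Tr}$ is the unnormalized trace, and let $U(N)$ be the group of $N\times N$ unitary matrices. A countable discrete group $\Gamma$ is called \emph{Frobenius stable} if, for every sequence of integers $N_n\ge 1$ and every sequence of functions $\rho_n:\Gamma\to U(N_n)$ with $\|\rho_n(xy)-\rho_n(x)\rho_n(y)\|_2\to 0$ as $n\to\infty$ for all $x,y\in\Gamma$, there is a sequence of group homomorphisms $\tilde\rho_n:\Gamma\to U(N_n)$ with $\|\tilde\rho_n(x)-\rho_n(x)\|_2\to 0$ as $n\to\infty$ for all $x\in\Gamma$. Theorem. Let $\Gamma$ be a torsion-free, finitely generated nilpotent group that is neither trivial nor isomorphic to $\mathbb{Z}$. Then $\Gamma$ is not Frobenius stable. That is, there are integers $N_n\ge1$ and functions $\rho_n:\Gamma\to U(N_n)$ such that $\|\rho_n(xy)-\rho_n(x)\rho_n(y)\|_2\to 0$ for all $x,y\in\Gamma$, but for no sequence of group homomorphisms $\tilde\rho_n:\Gamma\to U(N_n)$ does $\|\tilde\rho_n(x)-\rho_n(x)\|_2\to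 0$ hold for all $x\in\Gamma$. -/

import Mathlib

open Filter Topology

/-- The Frobenius norm `‖M‖₂ = √(Tr (M* M))`, with the unnormalized trace. -/
noncomputable def frobeniusNorm {N : ℕ} (M : Matrix (Fin N) (Fin N) ℂ) : ℝ :=
  Real.sqrt (Matrix.trace (M.conjTranspose * M)).re

/-- A sequence of functions `ρ n : Γ → U(N n)` is a Frobenius asymptotic homomorphism if
`‖ρ n (x y) - ρ n x * ρ n y‖₂ → 0` for all `x, y`. -/
def IsFrobeniusAsymptoticHom {Γ : Type*} [Group Γ] (N : ℕ → ℕ)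
    (ρ : ∀ n : ℕ, Γ → Matrix.unitaryGroup (Fin (N n)) ℂ) : Prop :=
  ∀ x y : Γ, Tendsto
    (fun n : ℕ => frobeniusNorm
      ((ρ n (x * y) : Matrix (Fin (N n)) (Fin (N n)) ℂ) -
        (ρ n x : Matrix (Fin (N n)) (Fin (N n)) ℂ) * (ρ n y : Matrix (Fin (N n)) (Fin (N n)) ℂ)))
    atTop (𝓝 0)

/-- A sequence `ρ n : Γ → U(N n)` is perturbable in the Frobenius norm to a sequence of genuine
representations if there are homomorphisms `π n : Γ → U(N n)`, into the same unitary groups, with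
`‖π n x - ρ n x‖₂ → 0` for all `x`. -/
def IsFrobeniusPerturbable {Γ : Type*} [Group Γ] (N : ℕ → ℕ)
    (ρ : ∀ n : ℕ, Γ → Matrix.unitaryGroup (Fin (N n)) ℂ) : Prop :=
  ∃ π : ∀ n : ℕ, Γ →* Matrix.unitaryGroup (Fin (N n)) ℂ,
    ∀ x : Γ, Tendsto
      (fun n : ℕ => frobeniusNorm
        ((π n x : Matrix (Fin (N n)) (Fin (N n)) ℂ) - (ρ n x : Matrix (Fin (N n)) (Fin (N n)) ℂ)))
      atTop (𝓝 0)

/-- `Γ` is Frobenius stable if every Frobenius asymptotic homomorphism, in positive dimensions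
`N n`, is perturbable in the Frobenius norm to a sequence of genuine representations. -/
def FrobeniusStable (Γ : Type*) [Group Γ] : Prop :=
  ∀ (N : ℕ → ℕ) (_ : ∀ n, 0 < N n) (ρ : ∀ n : ℕ, Γ → Matrix.unitaryGroup (Fin (N n)) ℂ),
    IsFrobeniusAsymptoticHom N ρ → IsFrobeniusPerturbable N ρ

/-! Γ maps onto ℤ with nontrivial kernel K; let t lift the generator and let φ be conjugation by t
on K. Nilpotency makes φ unipotent, which yields a character g : K → ℤ and some k ∈ K with g(k) ≠ 0
and φ(k)k⁻¹ torsion in the abelianization of K (`exists_almost_fixed`). For a large prime N, the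
partial sums h_i = Σ_{l<i} g ∘ φ^l give a diagonal representation D of K with entries e^(2πi h_i/N),
and the cyclic shift T satisfies T D(x) T⁻¹ = ζ^g(x) D(φ(x)) with ζ = e^(2πi/N)
(`orbitRep_rotation`). The scalar ζ^c is within 2π|c|/√N of 1 in Frobenius norm, so D and T assemble
into an asymptotic homomorphism of Γ.

The defect is still visible to the trace, since Tr(ζ^c - 1) → 2πic. Near the identity, log det has a
branch close to Tr(u - 1) that is additive and conjugation invariant. Given nearby genuine
representations with restriction A to K, its value L(x) at A(x)⁻¹D(x) is a homomorphism of K into a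
torsion-free abelian group, and L(φ(x)) = L(x) - 2πi g(x) (`comparisonHom_twist`). Such a
homomorphism takes equal values at k and φ(k), forcing g(k) = 0, a contradiction. -/

theorem frobeniusNorm_sq {N : ℕ} (M : Matrix (Fin N) (Fin N) ℂ) :
    frobeniusNorm M ^ 2 = ∑ i, ∑ j, ‖M i j‖ ^ 2 := by
  have h : (Matrix.trace (M.conjTranspose * M)).re = ∑ i, ∑ j, ‖M i j‖ ^ 2 := by
    rw [Finset.sum_comm]
    simp [Matrix.trace, Matrix.mul_apply, Complex.normSq_apply, Complex.sq_norm]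
  rw [frobeniusNorm, Real.sq_sqrt (by rw [h]; positivity), h]

theorem frobeniusNorm_nonneg {N : ℕ} (M : Matrix (Fin N) (Fin N) ℂ) : 0 ≤ frobeniusNorm M :=
  Real.sqrt_nonneg _

section FrobeniusInstances

open scoped Matrix.Norms.Frobenius

theorem frobeniusNorm_eq_norm {N : ℕ} (M : Matrix (Fin N) (Fin N) ℂ) : frobeniusNorm M = ‖M‖ := by
  rw [← Real.sqrt_sq (frobeniusNorm_nonneg M), frobeniusNorm_sq, Matrix.frobenius_norm_def,
    Real.sqrt_eq_rpow]
  simp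

theorem frobeniusNorm_add_le {N : ℕ} (A B : Matrix (Fin N) (Fin N) ℂ) :
    frobeniusNorm (A + B) ≤ frobeniusNorm A + frobeniusNorm B := by
  simpa only [frobeniusNorm_eq_norm] using norm_add_le A B

theorem frobeniusNorm_neg {N : ℕ} (A : Matrix (Fin N) (Fin N) ℂ) :
    frobeniusNorm (-A) = frobeniusNorm A := by
  simpa only [frobeniusNorm_eq_norm] using norm_neg A

theorem frobeniusNorm_conjTranspose {N : ℕ} (A : Matrix (Fin N) (Fin N) ℂ) :
    frobeniusNorm A.conjTranspose = frobeniusNorm A := by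
  simpa only [frobeniusNorm_eq_norm] using Matrix.frobenius_norm_conjTranspose A

theorem norm_toLp_mulVec_le_frobeniusNorm {N : ℕ} (A : Matrix (Fin N) (Fin N) ℂ) (v : Fin N → ℂ) :
    ‖WithLp.toLp 2 (A.mulVec v)‖ ≤ frobeniusNorm A * ‖WithLp.toLp 2 v‖ := by
  rw [frobeniusNorm_eq_norm, ← Matrix.frobenius_norm_replicateCol (ι := Unit),
    ← Matrix.frobenius_norm_replicateCol (ι := Unit), Matrix.replicateCol_mulVec]
  exact Matrix.frobenius_norm_mul _ _

end FrobeniusInstances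

theorem frobeniusNorm_unitary_mul {N : ℕ} (U : Matrix.unitaryGroup (Fin N) ℂ)
    (A : Matrix (Fin N) (Fin N) ℂ) :
    frobeniusNorm ((U : Matrix (Fin N) (Fin N) ℂ) * A) = frobeniusNorm A := by
  have h : (U : Matrix (Fin N) (Fin N) ℂ).conjTranspose * U = 1 := U.2.1
  rw [frobeniusNorm, frobeniusNorm, Matrix.conjTranspose_mul, Matrix.mul_assoc,
    ← Matrix.mul_assoc _ (U : Matrix (Fin N) (Fin N) ℂ) A, h, Matrix.one_mul]

theorem frobeniusNorm_mul_unitary {N : ℕ} (A : Matrix (Fin N) (Fin N) ℂ)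
    (U : Matrix.unitaryGroup (Fin N) ℂ) :
    frobeniusNorm (A * (U : Matrix (Fin N) (Fin N) ℂ)) = frobeniusNorm A := by
  have h : (U : Matrix (Fin N) (Fin N) ℂ).conjTranspose = ((U⁻¹ : Matrix.unitaryGroup (Fin N) ℂ) :
    Matrix (Fin N) (Fin N) ℂ) := rfl
  rw [← frobeniusNorm_conjTranspose, Matrix.conjTranspose_mul, h, frobeniusNorm_unitary_mul,
    frobeniusNorm_conjTranspose]

/-- The absolute value of `Tr (A B)` is at most `‖A‖₂ ‖B‖₂`. -/
theorem norm_trace_mul_le_frobeniusNorm {N : ℕ} (A B : Matrix (Fin N) (Fin N) ℂ) :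
    ‖(A * B).trace‖ ≤ frobeniusNorm A * frobeniusNorm B := by
  have h1 : ‖(A * B).trace‖ ≤ ∑ p : Fin N × Fin N, ‖A p.1 p.2‖ * ‖B p.2 p.1‖ := by
    rw [Matrix.trace, Fintype.sum_prod_type]
    refine (norm_sum_le _ _).trans (Finset.sum_le_sum fun i _ => ?_)
    rw [Matrix.diag_apply, Matrix.mul_apply]
    exact (norm_sum_le _ _).trans (Finset.sum_le_sum fun j _ => (norm_mul _ _).le)
  have h2 := Finset.sum_mul_sq_le_sq_mul_sq Finset.univ
    (fun p : Fin N × Fin N => ‖A p.1 p.2‖) (fun p => ‖B p.2 p.1‖)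
  rw [Fintype.sum_prod_type (fun p : Fin N × Fin N => ‖A p.1 p.2‖ ^ 2),
    Fintype.sum_prod_type_right (fun p : Fin N × Fin N => ‖B p.2 p.1‖ ^ 2)] at h2
  dsimp only at h2
  rw [← frobeniusNorm_sq, ← frobeniusNorm_sq, ← mul_pow] at h2
  exact h1.trans (le_of_sq_le_sq h2 (by
    have := frobeniusNorm_nonneg A; have := frobeniusNorm_nonneg B; positivity))

theorem frobeniusNorm_smul_one {N : ℕ} (z : ℂ) :
    frobeniusNorm (z • (1 : Matrix (Fin N) (Fin N) ℂ)) ^ 2 = N * ‖z‖ ^ 2 := by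
  rw [frobeniusNorm_sq]
  simp [Matrix.smul_apply, Matrix.one_apply, apply_ite, ite_pow]

theorem frobeniusNorm_diagonal_sq {N : ℕ} (w : Fin N → ℂ) :
    frobeniusNorm (Matrix.diagonal w) ^ 2 = ∑ i, ‖w i‖ ^ 2 := by
  rw [frobeniusNorm_sq]
  simp [Matrix.diagonal_apply, apply_ite, ite_pow]

/-! ### Diagonalization of unitaries near the identity -/

section L2Operator

open scoped Matrix.Norms.L2Operator

theorem Matrix.l2_opNorm_le_frobeniusNorm {N : ℕ} (A : Matrix (Fin N) (Fin N) ℂ) :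
    ‖A‖ ≤ frobeniusNorm A := by
  rw [Matrix.cstar_norm_def]
  refine ContinuousLinearMap.opNorm_le_bound _ (frobeniusNorm_nonneg A) fun v => ?_
  exact norm_toLp_mulVec_le_frobeniusNorm A v.ofLp

/-- A unitary matrix at Frobenius distance less than two from the identity is unitarily
diagonalizable. -/
theorem exists_unitary_diagonalization {N : ℕ} (u : Matrix.unitaryGroup (Fin N) ℂ)
    (hu : frobeniusNorm ((u : Matrix (Fin N) (Fin N) ℂ) - 1) < 2) :
    ∃ (V : Matrix.unitaryGroup (Fin N) ℂ) (w : Fin N → ℂ),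
      (u : Matrix (Fin N) (Fin N) ℂ) =
        (V : Matrix (Fin N) (Fin N) ℂ) * Matrix.diagonal w *
          ((V⁻¹ : Matrix.unitaryGroup (Fin N) ℂ) : Matrix (Fin N) (Fin N) ℂ) := by
  -- Distance below 2 keeps -1 out of the spectrum, so u = exp(iH) with H Hermitian, and
  -- diagonalizing H diagonalizes u.
  have h := congrArg Subtype.val
    (expUnitary_argSelfAdjoint (u := u) ((Matrix.l2_opNorm_le_frobeniusNorm _).trans_lt hu))
  rw [selfAdjoint.expUnitary_coe] at h
  set H := Unitary.argSelfAdjoint u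
  have hH : (H : Matrix (Fin N) (Fin N) ℂ).IsHermitian := H.2
  set V := hH.eigenvectorUnitary
  refine ⟨V, NormedSpace.exp (Complex.I • (RCLike.ofReal ∘ hH.eigenvalues)), ?_⟩
  have hV : (((Unitary.toUnits V)⁻¹ : (Matrix (Fin N) (Fin N) ℂ)ˣ) : Matrix (Fin N) (Fin N) ℂ) =
    ((V⁻¹ : Matrix.unitaryGroup (Fin N) ℂ) : Matrix (Fin N) (Fin N) ℂ) := rfl
  have key := Matrix.exp_units_conj (Unitary.toUnits V)
    (Matrix.diagonal (Complex.I • (RCLike.ofReal ∘ hH.eigenvalues)))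
  rw [Matrix.exp_diagonal, hV] at key
  refine Eq.trans ?_ key
  rw [← h]
  congr 1
  conv_lhs => rw [hH.spectral_theorem]
  rw [Unitary.conjStarAlgAut_apply, Matrix.diagonal_smul, Matrix.mul_smul, Matrix.smul_mul]
  rfl

end L2Operator

/-! ### A conjugation-invariant length on the unitary group -/

/-- The Frobenius distance of a unitary matrix to the identity. -/
noncomputable def distOne {N : ℕ} (u : Matrix.unitaryGroup (Fin N) ℂ) : ℝ :=
  frobeniusNorm ((u : Matrix (Fin N) (Fin N) ℂ) - 1)

section DistOne

variable {N : ℕ} (u v : Matrix.unitaryGroup (Fin N) ℂ)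

theorem distOne_nonneg : 0 ≤ distOne u := frobeniusNorm_nonneg _

theorem distOne_one : distOne (1 : Matrix.unitaryGroup (Fin N) ℂ) = 0 := by
  simp [distOne, frobeniusNorm]

theorem distOne_inv_mul : distOne (u⁻¹ * v) =
    frobeniusNorm ((u : Matrix (Fin N) (Fin N) ℂ) - (v : Matrix (Fin N) (Fin N) ℂ)) := by
  rw [distOne, ← frobeniusNorm_unitary_mul u, mul_sub, ← Submonoid.coe_mul, mul_inv_cancel_left,
    mul_one, ← frobeniusNorm_neg, neg_sub]

theorem distOne_mul_le : distOne (u * v) ≤ distOne u + distOne v := by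
  have h : ((u * v : Matrix.unitaryGroup (Fin N) ℂ) : Matrix (Fin N) (Fin N) ℂ) - 1 =
      (u : Matrix (Fin N) (Fin N) ℂ) * ((v : Matrix (Fin N) (Fin N) ℂ) - 1) +
        ((u : Matrix (Fin N) (Fin N) ℂ) - 1) := by
    rw [Submonoid.coe_mul, mul_sub]; simp
  rw [distOne, h]
  refine (frobeniusNorm_add_le _ _).trans ?_
  rw [frobeniusNorm_unitary_mul, add_comm]
  rfl

theorem distOne_inv : distOne u⁻¹ = distOne u := by
  have h := distOne_inv_mul u 1
  rwa [mul_one] at h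

theorem distOne_conj : distOne (v * u * v⁻¹) = distOne u := by
  have h : ((v * u * v⁻¹ : Matrix.unitaryGroup (Fin N) ℂ) : Matrix (Fin N) (Fin N) ℂ) - 1 =
      (v : Matrix (Fin N) (Fin N) ℂ) * ((u : Matrix (Fin N) (Fin N) ℂ) - 1) *
        ((v⁻¹ : Matrix.unitaryGroup (Fin N) ℂ) : Matrix (Fin N) (Fin N) ℂ) := by
    rw [mul_sub, sub_mul, mul_one, ← Submonoid.coe_mul, ← Submonoid.coe_mul, ← Submonoid.coe_mul,
      mul_inv_cancel]
    rfl
  rw [distOne, h, frobeniusNorm_mul_unitary, frobeniusNorm_unitary_mul]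
  rfl

end DistOne

/-! ### The branch of log det selected by the trace -/

/-- Sum the principal logarithms of the eigenvalues: |log(1 + z) - z| ≤ |z|² for |z| ≤ 1/2, and the
sum of |w i - 1|² is the squared Frobenius distance. The error is therefore independent of N. -/
theorem exists_log_det {N : ℕ} (u : Matrix.unitaryGroup (Fin N) ℂ) (hu : distOne u ≤ 1 / 2) :
    ∃ L : ℂ, Complex.exp L = (u : Matrix (Fin N) (Fin N) ℂ).det ∧
      ‖L - ((u : Matrix (Fin N) (Fin N) ℂ) - 1).trace‖ ≤ distOne u ^ 2 := by
  obtain ⟨V, w, hw⟩ := exists_unitary_diagonalization u (by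
    have : distOne u < 2 := by linarith
    exact this)
  have hVV : (V : Matrix (Fin N) (Fin N) ℂ) *
      ((V⁻¹ : Matrix.unitaryGroup (Fin N) ℂ) : Matrix (Fin N) (Fin N) ℂ) = 1 := by
    rw [← Submonoid.coe_mul, mul_inv_cancel]; rfl
  have hVV' : ((V⁻¹ : Matrix.unitaryGroup (Fin N) ℂ) : Matrix (Fin N) (Fin N) ℂ) *
      (V : Matrix (Fin N) (Fin N) ℂ) = 1 := by
    rw [← Submonoid.coe_mul, inv_mul_cancel]; rfl
  have hdet : (u : Matrix (Fin N) (Fin N) ℂ).det = ∏ i, w i := by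
    rw [hw, Matrix.det_mul_right_comm, hVV, one_mul, Matrix.det_diagonal]
  have hsub : (u : Matrix (Fin N) (Fin N) ℂ) - 1 = (V : Matrix (Fin N) (Fin N) ℂ) *
      Matrix.diagonal (fun i => w i - 1) *
        ((V⁻¹ : Matrix.unitaryGroup (Fin N) ℂ) : Matrix (Fin N) (Fin N) ℂ) := by
    have : Matrix.diagonal (fun i => w i - 1) = Matrix.diagonal w - 1 := by
      rw [← Matrix.diagonal_one, Matrix.diagonal_sub]
    rw [this, mul_sub, sub_mul, ← hw, mul_one, hVV]
  have htr : ((u : Matrix (Fin N) (Fin N) ℂ) - 1).trace = ∑ i, (w i - 1) := by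
    rw [hsub, Matrix.trace_mul_cycle, hVV', one_mul, Matrix.trace_diagonal]
  have hd : distOne u ^ 2 = ∑ i, ‖w i - 1‖ ^ 2 := by
    rw [distOne, hsub, frobeniusNorm_mul_unitary, frobeniusNorm_unitary_mul,
      frobeniusNorm_diagonal_sq]
  have hle : ∀ i, ‖w i - 1‖ ≤ 1 / 2 := fun i => by
    refine le_of_sq_le_sq ?_ (by norm_num)
    calc ‖w i - 1‖ ^ 2 ≤ ∑ i, ‖w i - 1‖ ^ 2 :=
          Finset.single_le_sum (f := fun i => ‖w i - 1‖ ^ 2) (fun _ _ => by positivity)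
            (Finset.mem_univ i)
      _ ≤ (1 / 2) ^ 2 := by rw [← hd]; exact pow_le_pow_left₀ (distOne_nonneg u) hu 2
  have hne : ∀ i, w i ≠ 0 := fun i h0 => by
    have := hle i
    rw [h0] at this
    norm_num at this
  refine ⟨∑ i, Complex.log (w i), ?_, ?_⟩
  · rw [Complex.exp_sum, hdet]
    exact Finset.prod_congr rfl fun i _ => Complex.exp_log (hne i)
  · rw [htr, hd, ← Finset.sum_sub_distrib]
    refine (norm_sum_le _ _).trans (Finset.sum_le_sum fun i _ => ?_)
    have h1 := Complex.norm_log_one_add_sub_self_le (z := w i - 1) ((hle i).trans_lt (by norm_num))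
    rw [add_sub_cancel] at h1
    refine h1.trans ?_
    have h2 : (1 - ‖w i - 1‖)⁻¹ ≤ 2 := by
      rw [inv_le_comm₀ (by linarith [hle i]) (by norm_num)]
      linarith [hle i]
    nlinarith [sq_nonneg ‖w i - 1‖]

/-- The branch of `log (det u)` that is close to `Tr (u - 1)`, for a unitary matrix `u` close to
the identity. -/
noncomputable def traceLog {N : ℕ} (u : Matrix.unitaryGroup (Fin N) ℂ) : ℂ :=
  Classical.epsilon fun L : ℂ => Complex.exp L = (u : Matrix (Fin N) (Fin N) ℂ).det ∧
    ‖L - ((u : Matrix (Fin N) (Fin N) ℂ) - 1).trace‖ ≤ distOne u ^ 2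

theorem traceLog_spec {N : ℕ} {u : Matrix.unitaryGroup (Fin N) ℂ} (hu : distOne u ≤ 1 / 2) :
    Complex.exp (traceLog u) = (u : Matrix (Fin N) (Fin N) ℂ).det ∧
      ‖traceLog u - ((u : Matrix (Fin N) (Fin N) ℂ) - 1).trace‖ ≤ distOne u ^ 2 :=
  Classical.epsilon_spec (exists_log_det u hu)

theorem eq_of_exp_eq_of_norm_sub_lt {x y : ℂ} (h : Complex.exp x = Complex.exp y)
    (hxy : ‖x - y‖ < 6) : x = y := by
  obtain ⟨n, hn⟩ := Complex.exp_eq_exp_iff_exists_int.mp h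
  rcases eq_or_ne n 0 with rfl | hn0
  · simpa using hn
  · exfalso
    have h1 : (1 : ℝ) ≤ |(n : ℝ)| := by exact_mod_cast Int.one_le_abs hn0
    have h2 : ‖x - y‖ = |(n : ℝ)| * (2 * Real.pi) := by
      rw [hn, add_sub_cancel_left, norm_mul, norm_mul, norm_mul, Complex.norm_I, mul_one,
        Complex.norm_intCast, Complex.norm_real, Real.norm_eq_abs, abs_of_pos Real.pi_pos]
      simp
    nlinarith [Real.pi_gt_three]

/-- Two logarithms of the determinant differ by a multiple of 2πi, and 5 + 1/4 < 6 < 2π, so even a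
crude bound identifies the branch. -/
theorem eq_traceLog {N : ℕ} {u : Matrix.unitaryGroup (Fin N) ℂ} (hu : distOne u ≤ 1 / 2) {L : ℂ}
    (hL : Complex.exp L = (u : Matrix (Fin N) (Fin N) ℂ).det)
    (hL' : ‖L - ((u : Matrix (Fin N) (Fin N) ℂ) - 1).trace‖ ≤ 5) : L = traceLog u := by
  obtain ⟨h1, h2⟩ := traceLog_spec hu
  refine eq_of_exp_eq_of_norm_sub_lt (hL.trans h1.symm) ?_
  have h3 := norm_sub_le_norm_sub_add_norm_sub L ((u : Matrix (Fin N) (Fin N) ℂ) - 1).trace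
    (traceLog u)
  rw [norm_sub_rev (Matrix.trace _) (traceLog u)] at h3
  nlinarith [distOne_nonneg u]

/-- With a = u - 1 and b = v - 1, uv - 1 = ab + a + b, and Cauchy–Schwarz bounds Tr(ab) by the
product of the Frobenius norms, without a factor of N. -/
theorem traceLog_mul {N : ℕ} {u v : Matrix.unitaryGroup (Fin N) ℂ} (hu : distOne u ≤ 1 / 4)
    (hv : distOne v ≤ 1 / 4) : traceLog (u * v) = traceLog u + traceLog v := by
  obtain ⟨hu1, hu2⟩ := traceLog_spec (hu.trans (by norm_num))
  obtain ⟨hv1, hv2⟩ := traceLog_spec (hv.trans (by norm_num))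
  refine (eq_traceLog ((distOne_mul_le u v).trans (by linarith)) ?_ ?_).symm
  · rw [Complex.exp_add, hu1, hv1, Submonoid.coe_mul, Matrix.det_mul]
  · have h : ((u * v : Matrix.unitaryGroup (Fin N) ℂ) : Matrix (Fin N) (Fin N) ℂ) - 1 =
        ((u : Matrix (Fin N) (Fin N) ℂ) - 1) * ((v : Matrix (Fin N) (Fin N) ℂ) - 1) +
          ((u : Matrix (Fin N) (Fin N) ℂ) - 1) + ((v : Matrix (Fin N) (Fin N) ℂ) - 1) := by
      rw [Submonoid.coe_mul]; noncomm_ring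
    have h2 := norm_trace_mul_le_frobeniusNorm ((u : Matrix (Fin N) (Fin N) ℂ) - 1)
      ((v : Matrix (Fin N) (Fin N) ℂ) - 1)
    change _ ≤ distOne u * distOne v at h2
    have hu0 := distOne_nonneg u
    have hv0 := distOne_nonneg v
    rw [h, Matrix.trace_add, Matrix.trace_add]
    set a := ((u : Matrix (Fin N) (Fin N) ℂ) - 1).trace
    set b := ((v : Matrix (Fin N) (Fin N) ℂ) - 1).trace
    set c := (((u : Matrix (Fin N) (Fin N) ℂ) - 1) * ((v : Matrix (Fin N) (Fin N) ℂ) - 1)).trace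
    calc ‖traceLog u + traceLog v - (c + a + b)‖
        = ‖(traceLog u - a) + (traceLog v - b) - c‖ := by congr 1; ring
      _ ≤ ‖traceLog u - a‖ + ‖traceLog v - b‖ + ‖c‖ :=
          (norm_sub_le _ _).trans (add_le_add_left (norm_add_le _ _) _)
      _ ≤ 5 := by nlinarith

theorem traceLog_conj {N : ℕ} (u v : Matrix.unitaryGroup (Fin N) ℂ) :
    traceLog (v * u * v⁻¹) = traceLog u := by
  have hVV : (v : Matrix (Fin N) (Fin N) ℂ) *
      ((v⁻¹ : Matrix.unitaryGroup (Fin N) ℂ) : Matrix (Fin N) (Fin N) ℂ) = 1 := by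
    rw [← Submonoid.coe_mul, mul_inv_cancel]; rfl
  have hVV' : ((v⁻¹ : Matrix.unitaryGroup (Fin N) ℂ) : Matrix (Fin N) (Fin N) ℂ) *
      (v : Matrix (Fin N) (Fin N) ℂ) = 1 := by
    rw [← Submonoid.coe_mul, inv_mul_cancel]; rfl
  rw [traceLog, traceLog, distOne_conj, Submonoid.coe_mul, Submonoid.coe_mul,
    Matrix.det_mul_right_comm, hVV, one_mul, Matrix.trace_sub, Matrix.trace_mul_cycle, hVV', one_mul,
    Matrix.trace_sub]

theorem traceLog_one {N : ℕ} : traceLog (1 : Matrix.unitaryGroup (Fin N) ℂ) = 0 :=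
  (eq_traceLog (by rw [distOne_one]; norm_num) (by simp) (by simp)).symm

theorem traceLog_inv {N : ℕ} {u : Matrix.unitaryGroup (Fin N) ℂ} (hu : distOne u ≤ 1 / 4) :
    traceLog u⁻¹ = -traceLog u := by
  have h := traceLog_mul hu ((distOne_inv u).le.trans hu)
  rw [mul_inv_cancel, traceLog_one] at h
  exact (neg_eq_of_add_eq_zero_right h.symm).symm

/-! ### Scalar roots of unity -/

/-- The scalar unitary matrix `e ^ (2 π i / N)`. -/
noncomputable def rootScalar (N : ℕ) : Matrix.unitaryGroup (Fin N) ℂ :=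
  ⟨Complex.exp (2 * Real.pi * Complex.I / N) • 1, by
    rw [Matrix.mem_unitaryGroup_iff, Matrix.star_eq_conjTranspose, Matrix.conjTranspose_smul,
      Matrix.conjTranspose_one, Matrix.smul_mul, Matrix.one_mul, smul_smul, Complex.star_def,
      Complex.mul_conj, Complex.normSq_eq_norm_sq, Complex.norm_exp]
    simp⟩

theorem coe_rootScalar_zpow (N : ℕ) (c : ℤ) :
    ((rootScalar N ^ c : Matrix.unitaryGroup (Fin N) ℂ) : Matrix (Fin N) (Fin N) ℂ) =
      Complex.exp (2 * Real.pi * Complex.I / N * c) • 1 := by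
  have key : ∀ n : ℕ, ((rootScalar N ^ n : Matrix.unitaryGroup (Fin N) ℂ) :
      Matrix (Fin N) (Fin N) ℂ) = Complex.exp (2 * Real.pi * Complex.I / N * n) • 1 := fun n => by
    rw [SubmonoidClass.coe_pow, rootScalar, smul_pow, one_pow, ← Complex.exp_nat_mul, mul_comm]
  obtain ⟨n, rfl | rfl⟩ := c.eq_nat_or_neg
  · rw [zpow_natCast, key]; simp
  · have h : ((rootScalar N ^ (-(n : ℤ)) : Matrix.unitaryGroup (Fin N) ℂ) :
        Matrix (Fin N) (Fin N) ℂ) = ((rootScalar N ^ n : Matrix.unitaryGroup (Fin N) ℂ) :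
        Matrix (Fin N) (Fin N) ℂ).conjTranspose := by
      rw [zpow_neg, zpow_natCast]; rfl
    rw [h, key, Matrix.conjTranspose_smul, Matrix.conjTranspose_one, Complex.star_def,
      ← Complex.exp_conj]
    congr 2
    simp [Complex.conj_ofNat]
    ring

theorem rootScalar_commute (N : ℕ) (u : Matrix.unitaryGroup (Fin N) ℂ) :
    Commute (rootScalar N) u := by
  apply Subtype.ext
  change (_ • (1 : Matrix (Fin N) (Fin N) ℂ)) * _ = _ * (_ • (1 : Matrix (Fin N) (Fin N) ℂ))
  rw [smul_mul_assoc, mul_smul_comm, one_mul, mul_one]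

theorem norm_exp_sub_one_le_two_mul (N : ℕ) (c : ℤ) :
    ‖Complex.exp (2 * Real.pi * Complex.I / N * c) - 1‖ ≤ 2 * Real.pi * |(c : ℝ)| / N := by
  have h := Real.norm_exp_I_mul_ofReal_sub_one_le (x := 2 * Real.pi / N * c)
  have e : Complex.I * ((2 * Real.pi / N * c : ℝ) : ℂ) = 2 * Real.pi * Complex.I / N * c := by
    push_cast; ring
  rw [e] at h
  refine h.trans_eq ?_
  rw [Real.norm_eq_abs, abs_mul, abs_of_nonneg (by positivity)]
  ring

theorem distOne_rootScalar_zpow_sq_le (N : ℕ) (c : ℤ) :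
    distOne (rootScalar N ^ c) ^ 2 ≤ (2 * Real.pi * |(c : ℝ)|) ^ 2 / N := by
  have e : ((rootScalar N ^ c : Matrix.unitaryGroup (Fin N) ℂ) : Matrix (Fin N) (Fin N) ℂ) - 1 =
      (Complex.exp (2 * Real.pi * Complex.I / N * c) - 1) • 1 := by
    rw [coe_rootScalar_zpow, sub_smul, one_smul]
  rw [distOne, e, frobeniusNorm_smul_one]
  have h := norm_exp_sub_one_le_two_mul N c
  rcases Nat.eq_zero_or_pos N with rfl | hN
  · simp
  · have hN' : (0 : ℝ) < N := by exact_mod_cast hN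
    calc (N : ℝ) * ‖Complex.exp (2 * Real.pi * Complex.I / N * c) - 1‖ ^ 2
        ≤ N * (2 * Real.pi * |(c : ℝ)| / N) ^ 2 := by gcongr
      _ = (2 * Real.pi * |(c : ℝ)|) ^ 2 / N := by field_simp

theorem tendsto_distOne_rootScalar_zpow {N : ℕ → ℕ} (hN : Tendsto N atTop atTop) (c : ℤ) :
    Tendsto (fun n => distOne (rootScalar (N n) ^ c)) atTop (𝓝 0) := by
  have h : Tendsto (fun n => distOne (rootScalar (N n) ^ c) ^ 2) atTop (𝓝 0) :=
    squeeze_zero (fun n => sq_nonneg _) (fun n => distOne_rootScalar_zpow_sq_le (N n) c)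
      (tendsto_const_nhds.div_atTop (tendsto_natCast_atTop_atTop.comp hN))
  have h2 := h.sqrt
  simpa only [Real.sqrt_sq (distOne_nonneg _), Real.sqrt_zero] using h2

/-- The determinant is 1, so 0 is also a logarithm of it; the trace N(e^(2πic/N) - 1), close to
2πic, selects the branch. -/
theorem eventually_traceLog_rootScalar_zpow {N : ℕ → ℕ} (hN : Tendsto N atTop atTop) (c : ℤ) :
    ∀ᶠ n in atTop, traceLog (rootScalar (N n) ^ c) = 2 * Real.pi * Complex.I * c := by
  have hd := (tendsto_distOne_rootScalar_zpow hN c).eventually (ge_mem_nhds one_half_pos)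
  have hz : Tendsto (fun n => ‖(2 * Real.pi * Complex.I * c : ℂ)‖ ^ 2 / (N n : ℝ)) atTop (𝓝 0) :=
    tendsto_const_nhds.div_atTop (tendsto_natCast_atTop_atTop.comp hN)
  filter_upwards [hd, hz.eventually (ge_mem_nhds one_pos),
    hN.eventually_ge_atTop (Nat.ceil ‖(2 * Real.pi * Complex.I * c : ℂ)‖ + 1)] with n h1 h2 h3
  have hNpos : (0 : ℝ) < N n := by exact_mod_cast (Nat.succ_pos _).trans_le h3
  have hN0 : (N n : ℂ) ≠ 0 := by exact_mod_cast hNpos.ne'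
  set z : ℂ := 2 * Real.pi * Complex.I * c with hzdef
  have hexp : (2 * Real.pi * Complex.I / (N n) * c : ℂ) = z / N n := by rw [hzdef]; ring
  have hnorm : ‖z / N n‖ = ‖z‖ / N n := by rw [norm_div, Complex.norm_natCast]
  have hsmall : ‖z / N n‖ ≤ 1 := by
    rw [hnorm, div_le_one hNpos]
    exact (Nat.le_ceil _).trans (by exact_mod_cast (Nat.le_succ _).trans h3)
  refine (eq_traceLog h1 ?_ ?_).symm
  · rw [coe_rootScalar_zpow, Matrix.det_smul, Matrix.det_one, mul_one, ← Complex.exp_nat_mul,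
      Fintype.card_fin, hexp, mul_div_cancel₀ _ hN0]
  · rw [coe_rootScalar_zpow, Matrix.trace_sub, Matrix.trace_smul, Matrix.trace_one,
      Fintype.card_fin, hexp, smul_eq_mul]
    have e : z - (Complex.exp (z / N n) * N n - N n) =
        -(N n * (Complex.exp (z / N n) - 1 - z / N n)) := by field_simp; ring
    rw [e, norm_neg, norm_mul, Complex.norm_natCast]
    calc (N n : ℝ) * ‖Complex.exp (z / N n) - 1 - z / N n‖ ≤ N n * ‖z / N n‖ ^ 2 := by
          gcongr; exact Complex.norm_exp_sub_one_sub_id_le hsmall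
      _ = ‖z‖ ^ 2 / N n := by rw [hnorm]; field_simp
      _ ≤ 5 := by linarith

/-! ### Germs of logarithmic traces -/

/-- The class, up to equality for all large indices, of the sequence `traceLog (X n)`. -/
noncomputable def traceLogGerm {N : ℕ → ℕ} (X : ∀ n, Matrix.unitaryGroup (Fin (N n)) ℂ) :
    Germ (atTop : Filter ℕ) ℂ :=
  ((fun n => traceLog (X n) : ℕ → ℂ) : Germ (atTop : Filter ℕ) ℂ)

/-- A sequence of unitaries whose Frobenius distance to the identity tends to zero. -/
def IsNullSeq {N : ℕ → ℕ} (X : ∀ n, Matrix.unitaryGroup (Fin (N n)) ℂ) : Prop :=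
  Tendsto (fun n => distOne (X n)) atTop (𝓝 0)

section NullSeq

variable {N : ℕ → ℕ} {X Y : ∀ n, Matrix.unitaryGroup (Fin (N n)) ℂ}

theorem IsNullSeq.mul (hX : IsNullSeq X) (hY : IsNullSeq Y) : IsNullSeq (X * Y) := by
  refine squeeze_zero (fun n => distOne_nonneg _) (fun n => distOne_mul_le (X n) (Y n)) ?_
  simpa using Tendsto.add hX hY

theorem IsNullSeq.inv (hX : IsNullSeq X) : IsNullSeq X⁻¹ := by
  simpa only [IsNullSeq, Pi.inv_apply, distOne_inv] using hX

theorem IsNullSeq.conj (hX : IsNullSeq X) (V : ∀ n, Matrix.unitaryGroup (Fin (N n)) ℂ) :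
    IsNullSeq (V * X * V⁻¹) := by
  simpa only [IsNullSeq, Pi.mul_apply, Pi.inv_apply, distOne_conj] using hX

theorem IsNullSeq.eventually_le (hX : IsNullSeq X) : ∀ᶠ n in atTop, distOne (X n) ≤ 1 / 4 :=
  Tendsto.eventually_le_const (by norm_num) hX

theorem traceLogGerm_mul (hX : IsNullSeq X) (hY : IsNullSeq Y) :
    traceLogGerm (X * Y) = traceLogGerm X + traceLogGerm Y := by
  rw [traceLogGerm, traceLogGerm, traceLogGerm, ← Germ.coe_add, Germ.coe_eq]
  filter_upwards [hX.eventually_le, hY.eventually_le] with n h1 h2 using traceLog_mul h1 h2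

theorem traceLogGerm_inv (hX : IsNullSeq X) : traceLogGerm X⁻¹ = -traceLogGerm X := by
  rw [traceLogGerm, traceLogGerm, ← Germ.coe_neg, Germ.coe_eq]
  filter_upwards [hX.eventually_le] with n h1 using traceLog_inv h1

theorem traceLogGerm_conj (X V : ∀ n, Matrix.unitaryGroup (Fin (N n)) ℂ) :
    traceLogGerm (V * X * V⁻¹) = traceLogGerm X := by
  simp only [traceLogGerm, Pi.mul_apply, Pi.inv_apply, traceLog_conj]

theorem traceLogGerm_one : traceLogGerm (1 : ∀ n, Matrix.unitaryGroup (Fin (N n)) ℂ) = 0 := by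
  simp only [traceLogGerm, Pi.one_apply, traceLog_one]
  rfl

theorem traceLogGerm_rootScalar_zpow (hN : Tendsto N atTop atTop) (c : ℤ) :
    traceLogGerm (fun n => rootScalar (N n) ^ c) =
      ((2 * Real.pi * Complex.I * c : ℂ) : Germ (atTop : Filter ℕ) ℂ) :=
  Germ.coe_eq.mpr (eventually_traceLog_rootScalar_zpow hN c)

end NullSeq

/-! ### The obstruction to perturbing a twisted representation -/

section Obstruction

variable {K : Type*} [Group K] {N : ℕ → ℕ}

/-- The logarithmic trace comparing two asymptotically equal sequences of representations, as a
homomorphism to germs of complex sequences. -/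
noncomputable def comparisonHom (A D : K →* ∀ n, Matrix.unitaryGroup (Fin (N n)) ℂ)
    (h : ∀ k, IsNullSeq ((A k)⁻¹ * D k)) :
    K →* Multiplicative (Germ (atTop : Filter ℕ) ℂ) where
  toFun k := Multiplicative.ofAdd (traceLogGerm ((A k)⁻¹ * D k))
  map_one' := by rw [map_one, map_one, inv_one, mul_one, traceLogGerm_one]; rfl
  map_mul' k l := by
    have e : (A (k * l))⁻¹ * D (k * l) =
        ((A l)⁻¹ * D l) * ((D l)⁻¹ * ((A k)⁻¹ * D k) * (D l)⁻¹⁻¹) := by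
      rw [map_mul, map_mul]; group
    rw [e, traceLogGerm_mul (h l) ((h k).conj _), traceLogGerm_conj, ← ofAdd_add, add_comm]

/-- Besides the scalar ζ^(-g k), the mismatch Q = S⁻¹T contributes once as a conjugate of Q and once
as Q⁻¹, so its logarithms cancel. -/
theorem comparisonHom_twist (hN : Tendsto N atTop atTop)
    (A D : K →* ∀ n, Matrix.unitaryGroup (Fin (N n)) ℂ)
    (S T : ∀ n, Matrix.unitaryGroup (Fin (N n)) ℂ) (φ : K → K) (g : K → ℤ)
    (hA : ∀ k, S * A k * S⁻¹ = A (φ k))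
    (hD : ∀ k, T * D k * T⁻¹ = (fun n => rootScalar (N n) ^ g k) * D (φ k))
    (h : ∀ k, IsNullSeq ((A k)⁻¹ * D k)) (hST : IsNullSeq (S⁻¹ * T)) (k : K) :
    Multiplicative.toAdd (comparisonHom A D h (φ k)) =
      ((2 * Real.pi * Complex.I * (-g k : ℤ) : ℂ) : Germ (atTop : Filter ℕ) ℂ) +
        Multiplicative.toAdd (comparisonHom A D h k) := by
  set Q := S⁻¹ * T with hQ
  set ζ : ∀ n, Matrix.unitaryGroup (Fin (N n)) ℂ := fun n => rootScalar (N n) ^ (-g k) with hζ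
  have hDφ : D (φ k) = ζ * (T * D k * T⁻¹) := by
    rw [hD, hζ, ← mul_assoc]
    have : ((fun n => rootScalar (N n) ^ (-g k)) * fun n => rootScalar (N n) ^ g k :
        ∀ n, Matrix.unitaryGroup (Fin (N n)) ℂ) = 1 := by
      funext n
      simp
    rw [this, one_mul]
  have hcomm : ∀ X : ∀ n, Matrix.unitaryGroup (Fin (N n)) ℂ, X * ζ = ζ * X := fun X => by
    funext n
    exact (((rootScalar_commute (N n) (X n)).zpow_left (-g k)).symm).eq
  have e : (A (φ k))⁻¹ * D (φ k) =
      ζ * (S * ((((A k)⁻¹ * Q * (A k)⁻¹⁻¹) * ((A k)⁻¹ * D k)) * Q⁻¹) * S⁻¹) := by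
    rw [hDφ, ← mul_assoc, hcomm, mul_assoc, ← hA, hQ]
    group
  have hQn : IsNullSeq ((A k)⁻¹ * Q * (A k)⁻¹⁻¹) := hST.conj _
  have hζn : IsNullSeq ζ := tendsto_distOne_rootScalar_zpow hN (-g k)
  change traceLogGerm ((A (φ k))⁻¹ * D (φ k)) = _ + traceLogGerm ((A k)⁻¹ * D k)
  rw [e, traceLogGerm_mul hζn (((hQn.mul (h k)).mul hST.inv).conj S), traceLogGerm_conj,
    traceLogGerm_mul (hQn.mul (h k)) hST.inv, traceLogGerm_mul hQn (h k), traceLogGerm_conj,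
    traceLogGerm_inv hST, hζ, traceLogGerm_rootScalar_zpow hN]
  abel

/-- If representations twisted by `e ^ (2 π i g / N)` are asymptotically equal to untwisted ones,
then `g` vanishes on every element whose conjugation defect is torsion in the abelianization. -/
theorem twist_eq_zero (hN : Tendsto N atTop atTop)
    (A D : K →* ∀ n, Matrix.unitaryGroup (Fin (N n)) ℂ)
    (S T : ∀ n, Matrix.unitaryGroup (Fin (N n)) ℂ) (φ : K → K) (g : K → ℤ)
    (hA : ∀ k, S * A k * S⁻¹ = A (φ k))
    (hD : ∀ k, T * D k * T⁻¹ = (fun n => rootScalar (N n) ^ g k) * D (φ k))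
    (h : ∀ k, IsNullSeq ((A k)⁻¹ * D k)) (hST : IsNullSeq (S⁻¹ * T)) {k : K} {m : ℕ} (hm : m ≠ 0)
    (hk : (φ k * k⁻¹) ^ m ∈ commutator K) : g k = 0 := by
  have h1 := Abelianization.commutator_subset_ker (comparisonHom A D h) hk
  rw [MonoidHom.mem_ker, map_pow, map_mul, map_inv] at h1
  have h2 := congrArg Multiplicative.toAdd h1
  -- The values of the comparison homomorphism at `k` cancel, leaving m · 2πi · (-g k) = 0 as
  -- constant germs.
  rw [toAdd_pow, toAdd_mul, toAdd_inv, comparisonHom_twist hN A D S T φ g hA hD h hST,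
    add_neg_cancel_right, toAdd_one] at h2
  have h3 : ((m • (2 * Real.pi * Complex.I * (-g k : ℤ)) : ℂ) : Germ (atTop : Filter ℕ) ℂ) =
      ((0 : ℂ) : Germ (atTop : Filter ℕ) ℂ) := h2
  have h4 := Germ.const_inj.mp h3
  simpa [hm, Real.pi_ne_zero] using h4

end Obstruction

/-! ### Diagonal representations and the cyclic shift -/

/-- A diagonal matrix with entries on the unit circle, as a unitary matrix. -/
noncomputable def unitaryDiagonal (N : ℕ) (w : Fin N → Circle) : Matrix.unitaryGroup (Fin N) ℂ :=
  ⟨Matrix.diagonal fun i => (w i : ℂ), by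
    rw [Matrix.mem_unitaryGroup_iff, Matrix.star_eq_conjTranspose, Matrix.diagonal_conjTranspose,
      Matrix.diagonal_mul_diagonal, ← Matrix.diagonal_one]
    congr 1
    funext i
    simp [Complex.mul_conj]⟩

/-- The permutation matrix of the cyclic rotation, as a unitary matrix. -/
noncomputable def unitaryRotation (N : ℕ) : Matrix.unitaryGroup (Fin N) ℂ :=
  ⟨(finRotate N).permMatrix ℂ, by
    rw [Matrix.mem_unitaryGroup_iff, Matrix.star_eq_conjTranspose, Matrix.conjTranspose_permMatrix,
      ← Matrix.permMatrix_mul, inv_mul_cancel, Matrix.permMatrix_one]⟩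

theorem unitaryRotation_mul_diagonal (N : ℕ) (w : Fin N → Circle) :
    unitaryRotation N * unitaryDiagonal N w =
      unitaryDiagonal N (w ∘ finRotate N) * unitaryRotation N := by
  apply Subtype.ext
  ext i j
  change ((finRotate N).permMatrix ℂ * Matrix.diagonal fun i => (w i : ℂ)) i j =
    ((Matrix.diagonal fun i => (w (finRotate N i) : ℂ)) * (finRotate N).permMatrix ℂ) i j
  rw [Matrix.mul_diagonal, Matrix.diagonal_mul, Equiv.Perm.permMatrix, PEquiv.toMatrix_apply]
  by_cases hij : finRotate N i = j
  · simp [hij]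
  · rw [if_neg (by simpa only [Equiv.toPEquiv_apply, Option.mem_def, Option.some_inj] using hij),
      mul_zero, zero_mul]

/-- The point `e ^ (2 π i / N)` of the unit circle. -/
noncomputable def rootCircle (N : ℕ) : Circle := Circle.exp (2 * Real.pi / N)

theorem rootCircle_zpow_eq_one {N : ℕ} (hN : N ≠ 0) {c : ℤ} (hc : (N : ℤ) ∣ c) :
    rootCircle N ^ c = 1 := by
  obtain ⟨b, rfl⟩ := hc
  rw [zpow_mul, zpow_natCast, rootCircle, ← Circle.exp_nsmul, nsmul_eq_mul,
    mul_div_cancel₀ _ (by exact_mod_cast hN), Circle.exp_two_pi, one_zpow]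

theorem rootScalar_zpow_eq (N : ℕ) (c : ℤ) :
    rootScalar N ^ c = unitaryDiagonal N fun _ => rootCircle N ^ c := by
  apply Subtype.ext
  rw [coe_rootScalar_zpow]
  change _ = Matrix.diagonal _
  rw [Matrix.smul_one_eq_diagonal]
  congr 1
  funext i
  rw [rootCircle, ← Circle.exp_zsmul, Circle.coe_exp]
  congr 1
  push_cast
  simp
  ring

/-- Partial sums of an integral character along the orbit of an automorphism. -/
def orbitSum {K : Type*} [Group K] (φ : MulAut K) (g : K →* Multiplicative ℤ) (i : ℕ) :
    K →* Multiplicative ℤ :=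
  ∏ l ∈ Finset.range i, g.comp (φ ^ l : MulAut K).toMonoidHom

theorem orbitSum_succ_apply {K : Type*} [Group K] (φ : MulAut K) (g : K →* Multiplicative ℤ) (i : ℕ)
    (k : K) : orbitSum φ g (i + 1) k = g k * orbitSum φ g i (φ k) := by
  rw [orbitSum, Finset.prod_range_succ', orbitSum, MonoidHom.mul_apply, MonoidHom.finsetProd_apply,
    MonoidHom.finsetProd_apply, mul_comm]
  rfl

/-- The diagonal representation whose characters are `e ^ (2 π i h / N)` for the partial orbit
sums `h`. -/
noncomputable def orbitRep {K : Type*} [Group K] (φ : MulAut K) (g : K →* Multiplicative ℤ) (N : ℕ) :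
    K →* Matrix.unitaryGroup (Fin N) ℂ where
  toFun k := unitaryDiagonal N fun i => rootCircle N ^ Multiplicative.toAdd (orbitSum φ g i k)
  map_one' := by
    apply Subtype.ext
    simp [unitaryDiagonal]
  map_mul' k l := by
    apply Subtype.ext
    simp [unitaryDiagonal, zpow_add]

/-- The shift replaces h_i(k) by h_{i+1}(k) = g(k) + h_i(φ(k)). Divisibility is needed only at the
last index, which wraps around to h_0 = 0 instead of h_N. -/
theorem orbitRep_rotation {K : Type*} [Group K] (φ : MulAut K) (g : K →* Multiplicative ℤ) {N : ℕ}
    (hN : ∀ k, (N : ℤ) ∣ Multiplicative.toAdd (orbitSum φ g N k)) (k : K) :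
    unitaryRotation N * orbitRep φ g N k * (unitaryRotation N)⁻¹ =
      rootScalar N ^ Multiplicative.toAdd (g k) * orbitRep φ g N (φ k) := by
  rw [mul_inv_eq_iff_eq_mul]
  change unitaryRotation N * unitaryDiagonal N _ = _ * unitaryDiagonal N _ * _
  rw [unitaryRotation_mul_diagonal, rootScalar_zpow_eq]
  congr 1
  apply Subtype.ext
  change Matrix.diagonal _ = Matrix.diagonal _ * Matrix.diagonal _
  rw [Matrix.diagonal_mul_diagonal]
  congr 1
  funext i
  rw [← Circle.coe_mul, ← zpow_add, ← toAdd_mul, ← orbitSum_succ_apply]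
  congr 1
  cases N with
  | zero => exact i.elim0
  | succ n =>
    change rootCircle (n + 1) ^ Multiplicative.toAdd (orbitSum φ g (finRotate (n + 1) i : ℕ) k) = _
    rcases eq_or_ne i (Fin.last n) with rfl | hi
    · rw [finRotate_last, Fin.val_last, rootCircle_zpow_eq_one n.succ_ne_zero (hN k)]
      simp [orbitSum]
    · rw [coe_finRotate_of_ne_last hi]

/-! ### Extension from the kernel to the whole group -/

section Extension

variable {Γ : Type*} [Group Γ] (τ : Γ →* Multiplicative ℤ) (t : Γ)
  (ht : τ t = Multiplicative.ofAdd 1)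

/-- The component of an element in the kernel of `τ`, relative to the splitting `t`. -/
def kerPart (ht : τ t = Multiplicative.ofAdd 1) (x : Γ) : τ.ker :=
  ⟨x * t ^ (-Multiplicative.toAdd (τ x)), by
    rw [MonoidHom.mem_ker, map_mul, map_zpow, ht]
    apply Multiplicative.toAdd.injective
    simp⟩

theorem kerPart_mul (x y : Γ) : kerPart τ t ht (x * y) = kerPart τ t ht x *
    ((MulAut.conjNormal t : MulAut τ.ker) ^ Multiplicative.toAdd (τ x)) (kerPart τ t ht y) := by
  apply Subtype.ext
  rw [← map_zpow, Subgroup.coe_mul, MulAut.conjNormal_apply]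
  simp only [kerPart, map_mul, toAdd_mul]
  group

/-- The function on `Γ` assembled from a representation of the kernel of `τ` and the image of the
splitting `t`. -/
def extendByPowers (ht : τ t = Multiplicative.ofAdd 1) {U : Type*} [Group U] (D : τ.ker →* U)
    (T : U) (x : Γ) : U :=
  D (kerPart τ t ht x) * T ^ Multiplicative.toAdd (τ x)

theorem extendByPowers_coe {U : Type*} [Group U] (D : τ.ker →* U) (T : U) (k : τ.ker) :
    extendByPowers τ t ht D T k = D k := by
  have hk : τ k = 1 := k.2
  have : kerPart τ t ht k = k := Subtype.ext (by simp [kerPart, hk])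
  rw [extendByPowers, this, hk, toAdd_one, zpow_zero, mul_one]

theorem extendByPowers_self {U : Type*} [Group U] (D : τ.ker →* U) (T : U) :
    extendByPowers τ t ht D T t = T := by
  have : kerPart τ t ht t = 1 := Subtype.ext (by simp [kerPart, ht])
  rw [extendByPowers, this, ht, map_one, one_mul, toAdd_ofAdd, zpow_one]

theorem exists_conj_zpow_eq {K : Type*} [Group K] (φ : MulAut K) {U : ℕ → Type*}
    [∀ n, Group (U n)] (D : ∀ n, K →* U n) (T ζ : ∀ n, U n) (hζ : ∀ n u, Commute (ζ n) u)
    (g : K → ℤ) (hD : ∀ n k, T n * D n k * (T n)⁻¹ = ζ n ^ g k * D n (φ k)) (a : ℤ) (k : K) :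
    ∃ c : ℤ, ∀ n, T n ^ a * D n k = ζ n ^ c * D n ((φ ^ a) k) * T n ^ a := by
  induction a using Int.induction_on with
  | zero => exact ⟨0, fun n => by simp⟩
  | succ a ih =>
    obtain ⟨c, hc⟩ := ih
    refine ⟨c + g ((φ ^ (a : ℤ)) k), fun n => ?_⟩
    have h1 := hD n ((φ ^ (a : ℤ)) k)
    rw [mul_inv_eq_iff_eq_mul, ← MulAut.mul_apply, ← zpow_one_add] at h1
    rw [add_comm (a : ℤ) 1, zpow_one_add, mul_assoc, hc, ← mul_assoc, ← mul_assoc,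
      ← ((hζ n (T n)).zpow_left c).eq, mul_assoc (ζ n ^ c), h1, zpow_add (ζ n)]
    simp only [mul_assoc]
  | pred a ih =>
    obtain ⟨c, hc⟩ := ih
    refine ⟨c - g ((φ ^ (-(a : ℤ) - 1)) k), fun n => ?_⟩
    have h1 := hD n ((φ ^ (-(a : ℤ) - 1)) k)
    rw [mul_inv_eq_iff_eq_mul, ← MulAut.mul_apply, ← zpow_one_add, add_sub_cancel] at h1
    rw [← mul_right_inj (T n), ← mul_assoc, ← mul_assoc, ← zpow_one_add, add_sub_cancel, hc,
      ← mul_assoc, ← ((hζ n (T n)).zpow_left _).eq, mul_assoc _ (T n), h1, ← mul_assoc, ← mul_assoc,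
      ← zpow_add, sub_add_cancel, mul_assoc _ (T n), ← zpow_one_add, add_sub_cancel]

/-- The exponent `c` does not depend on `n`; this is what makes the scalar defect tend to 1. -/
theorem exists_extendByPowers_mul_eq {U : ℕ → Type*} [∀ n, Group (U n)] (D : ∀ n, τ.ker →* U n)
    (T ζ : ∀ n, U n) (hζ : ∀ n u, Commute (ζ n) u) (g : τ.ker → ℤ)
    (hD : ∀ n k, T n * D n k * (T n)⁻¹ =
      ζ n ^ g k * D n ((MulAut.conjNormal t : MulAut τ.ker) k)) (x y : Γ) :
    ∃ c : ℤ, ∀ n, extendByPowers τ t ht (D n) (T n) x * extendByPowers τ t ht (D n) (T n) y =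
      extendByPowers τ t ht (D n) (T n) (x * y) * ζ n ^ c := by
  obtain ⟨c, hc⟩ := exists_conj_zpow_eq (MulAut.conjNormal t : MulAut τ.ker) D T ζ hζ g hD
    (Multiplicative.toAdd (τ x)) (kerPart τ t ht y)
  refine ⟨c, fun n => ?_⟩
  rw [← ((hζ n _).zpow_left c).eq]
  simp only [extendByPowers]
  rw [kerPart_mul, map_mul, map_mul, toAdd_mul, zpow_add, mul_assoc, ← mul_assoc (T n ^ _), hc,
    ← mul_assoc, ← mul_assoc, ← mul_assoc, ← ((hζ n (D n _)).zpow_left c).eq]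
  simp only [mul_assoc]

/-- An integral character of the kernel of a surjection to `ℤ`, with divisible orbit sums, whose
restriction to some element fixed modulo torsion in the abelianization is nonzero, obstructs
Frobenius stability. -/
theorem not_frobeniusStable_of_character (g : τ.ker →* Multiplicative ℤ) (d : ℕ)
    (hdvd : ∀ p : ℕ, p.Prime → d ≤ p → ∀ k, (p : ℤ) ∣ Multiplicative.toAdd
      (orbitSum (MulAut.conjNormal t : MulAut τ.ker) g p k))
    {k : τ.ker} (hgk : g k ≠ 1) {m : ℕ} (hm : m ≠ 0)
    (hk : ((MulAut.conjNormal t : MulAut τ.ker) k * k⁻¹) ^ m ∈ commutator τ.ker)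
    (ht : τ t = Multiplicative.ofAdd 1) :
    ¬ FrobeniusStable Γ := by
  intro hstable
  choose N hNge hNprime using fun n : ℕ => Nat.exists_infinite_primes (n + d)
  have hNtop : Tendsto N atTop atTop :=
    tendsto_atTop_mono (fun n => (Nat.le_add_right n d).trans (hNge n)) tendsto_id
  set φ : MulAut τ.ker := MulAut.conjNormal t with hφ
  set D : ∀ n, τ.ker →* Matrix.unitaryGroup (Fin (N n)) ℂ := fun n => orbitRep φ g (N n)
  set T : ∀ n, Matrix.unitaryGroup (Fin (N n)) ℂ := fun n => unitaryRotation (N n)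
  have hD : ∀ n k, T n * D n k * (T n)⁻¹ =
      rootScalar (N n) ^ Multiplicative.toAdd (g k) * D n (φ k) := fun n k =>
    orbitRep_rotation φ g (hdvd _ (hNprime n) ((Nat.le_add_left d n).trans (hNge n))) k
  obtain ⟨π, hπ⟩ := hstable N (fun n => (hNprime n).pos)
    (fun n => extendByPowers τ t ht (D n) (T n)) (fun x y => by
      obtain ⟨c, hc⟩ := exists_extendByPowers_mul_eq τ t ht D T (fun n => rootScalar (N n))
        (fun n => rootScalar_commute (N n)) _ hD x y
      refine (tendsto_distOne_rootScalar_zpow hNtop c).congr fun n => ?_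
      rw [← Submonoid.coe_mul, ← distOne_inv_mul, hc, inv_mul_cancel_left])
  have hnull : ∀ x, IsNullSeq ((fun n => (π n x)⁻¹) *
      fun n => extendByPowers τ t ht (D n) (T n) x) := fun x =>
    (hπ x).congr fun n => (distOne_inv_mul _ _).symm
  have key := twist_eq_zero hNtop (MonoidHom.pi fun n => (π n).comp τ.ker.subtype)
    (MonoidHom.pi D) (fun n => π n t) T φ (fun k => Multiplicative.toAdd (g k))
    (fun k => by
      funext n
      change π n t * π n k * (π n t)⁻¹ = π n (φ k : τ.ker)
      rw [hφ, MulAut.conjNormal_apply, map_mul, map_mul, map_inv])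
    (fun k => funext fun n => hD n k)
    (fun k => by
      have := hnull k
      simp only [extendByPowers_coe] at this
      exact this)
    (by
      have := hnull t
      simp only [extendByPowers_self] at this
      exact this) hm hk
  exact hgk (Multiplicative.toAdd.injective key)

end Extension

/-! ### Integral characters of nilpotent groups -/

open scoped commutatorElement in
/-- A nontrivial torsion-free nilpotent group has an element of infinite order in its
abelianization. -/
theorem exists_pow_notMem_commutator {G : Type*} [Group G] [Group.IsNilpotent G] [Nontrivial G]
    (htf : ∀ g : G, g ≠ 1 → ¬ IsOfFinOrder g) :
    ∃ x : G, ∀ m : ℕ, m ≠ 0 → x ^ m ∉ commutator G := by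
  by_cases hc : Subgroup.center G = ⊤
  · obtain ⟨x, hx⟩ := exists_ne (1 : G)
    refine ⟨x, fun m hm hmem => htf x hx ?_⟩
    rw [commutator_def, Subgroup.commutator_eq_bot_iff_le_centralizer.mpr (by
      rw [Subgroup.coe_top, Subgroup.centralizer_univ, hc]), Subgroup.mem_bot] at hmem
    exact isOfFinOrder_iff_pow_eq_one.mpr ⟨m, Nat.pos_of_ne_zero hm, hmem⟩
  · have hle : Subgroup.upperCentralSeries G 1 ≤ Subgroup.upperCentralSeries G 2 :=
      Subgroup.upperCentralSeries_mono G (by norm_num)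
    have hne : Subgroup.upperCentralSeries G 1 ≠ Subgroup.upperCentralSeries G 2 := fun h => hc <| by
      rw [← Subgroup.upperCentralSeries_one]
      exact Subgroup.upperCentralSeries.eq_top (by norm_num) h
    -- For z in the second center but not in the center, x ↦ [z, x] is a nontrivial homomorphism
    -- into the torsion-free center, and it kills commutators.
    obtain ⟨z, hz2, hz1⟩ := SetLike.exists_of_lt (lt_of_le_of_ne hle hne)
    rw [Subgroup.mem_upperCentralSeries_succ_iff, Subgroup.upperCentralSeries_one] at hz2
    let f : G →* Subgroup.center G := MonoidHom.mk' (fun x => ⟨⁅z, x⁆, hz2 x⟩) fun x y => by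
      apply Subtype.ext
      have h := Subgroup.mem_center_iff.mp (hz2 y) x
      calc ⁅z, x * y⁆ = ⁅z, x⁆ * (x * ⁅z, y⁆) * x⁻¹ := by simp only [commutatorElement_def]; group
        _ = ⁅z, x⁆ * ⁅z, y⁆ := by rw [h]; group
    rw [Subgroup.upperCentralSeries_one, Subgroup.mem_center_iff] at hz1
    push Not at hz1
    obtain ⟨x, hx⟩ := hz1
    refine ⟨x, fun m hm hmem => htf ⁅z, x⁆ (fun h => hx ?_) ?_⟩
    · exact (commutatorElement_eq_one_iff_mul_comm.mp h).symm
    · have hker : commutator G ≤ f.ker := Subgroup.commutator_le.mpr fun a _ b _ => by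
        rw [MonoidHom.mem_ker, map_commutatorElement, commutatorElement_eq_one_iff_mul_comm]
        exact Subtype.ext (Subgroup.mem_center_iff.mp (f b).2 _)
      have h1 := hker hmem
      rw [MonoidHom.mem_ker, map_pow] at h1
      exact isOfFinOrder_iff_pow_eq_one.mpr
        ⟨m, Nat.pos_of_ne_zero hm, congrArg Subtype.val h1⟩

/-- An element of infinite order in a finitely generated abelianization is detected by an integral
character. -/
theorem exists_character_ne_one {G : Type*} [Group G] [Group.FG (Abelianization G)] {x : G}
    (hx : ∀ m : ℕ, m ≠ 0 → x ^ m ∉ commutator G) : ∃ g : G →* Multiplicative ℤ, g x ≠ 1 := by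
  have : Module.Finite ℤ (Additive (Abelianization G)) :=
    Module.Finite.iff_addGroup_fg.mpr inferInstance
  set a : Additive (Abelianization G) := Additive.ofMul (Abelianization.of x) with ha
  set q := (Submodule.torsion ℤ (Additive (Abelianization G))).mkQ
  have hqa : q a ≠ 0 := fun h => by
    rw [Submodule.mkQ_apply, Submodule.Quotient.mk_eq_zero, Submodule.mem_torsion_iff] at h
    obtain ⟨⟨n, hn⟩, hna⟩ := h
    have hn0 : n.natAbs ≠ 0 := by simpa using nonZeroDivisors.ne_zero hn
    apply hx _ hn0
    have h1 : n.natAbs • a = 0 := by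
      have h2 : n • a = 0 := hna
      rcases Int.natAbs_eq n with h3 | h3
      · rwa [h3, natCast_zsmul] at h2
      · rwa [h3, neg_smul, natCast_zsmul, neg_eq_zero] at h2
    rw [← Abelianization.ker_of, MonoidHom.mem_ker, map_pow]
    exact h1
  -- The quotient by torsion is finitely generated and torsion-free over ℤ, hence free, so
  -- functionals separate its points.
  obtain ⟨f, hf⟩ := Module.Projective.exists_dual_ne_zero ℤ hqa
  refine ⟨(AddMonoidHom.toMultiplicativeRight ((f ∘ₗ q).toAddMonoidHom)).comp Abelianization.of, hf⟩

/-- A nontrivial integral character can be divided to a surjective one. -/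
theorem exists_character_eq_ofAdd_one {G : Type*} [Group G] {f : G →* Multiplicative ℤ} {x : G}
    (hx : f x ≠ 1) : ∃ (τ : G →* Multiplicative ℤ) (t : G), τ t = Multiplicative.ofAdd 1 := by
  have hinf : Infinite f.range := by
    refine Infinite.of_injective (fun n : ℕ => (⟨f x ^ n, x ^ n, map_pow f x n⟩ : f.range)) ?_
    intro m n h
    have h1 : m • Multiplicative.toAdd (f x) = n • Multiplicative.toAdd (f x) :=
      congrArg (fun y : f.range => Multiplicative.toAdd (y : Multiplicative ℤ)) h
    have h2 : Multiplicative.toAdd (f x) ≠ 0 := hx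
    simpa [h2] using h1
  -- The range, an infinite subgroup of ℤ, is infinite cyclic.
  obtain ⟨t, ht⟩ := f.rangeRestrict_surjective (intCyclicMulEquiv (Multiplicative.ofAdd 1))
  exact ⟨intCyclicMulEquiv.symm.toMonoidHom.comp f.rangeRestrict, t, by
    change intCyclicMulEquiv.symm (f.rangeRestrict t) = _
    rw [ht, MulEquiv.symm_apply_apply]⟩

/-! ### Unipotent automorphisms -/

section UnipotentAutomorphism

variable {K : Type*} [Group K] (φ : MulAut K)

theorem fwdDiff_iter_character (g : K →* Multiplicative ℤ) (j : ℕ) (k : K) :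
    (fwdDiff 1)^[j] (fun l : ℕ => Multiplicative.toAdd (g ((φ ^ l) k))) =
      fun l : ℕ => Multiplicative.toAdd (g ((φ ^ l) ((fun k => φ k * k⁻¹)^[j] k))) := by
  induction j generalizing k with
  | zero => rfl
  | succ j ih =>
    rw [Function.iterate_succ_apply, Function.iterate_succ_apply, ← ih]
    congr 1
    funext l
    rw [fwdDiff, map_mul, map_mul, map_inv, map_inv, toAdd_mul, toAdd_inv, pow_succ,
      MulAut.mul_apply, sub_eq_add_neg]

/-- The orbit sums of length `p` of a unipotent automorphism are divisible by large primes `p`. -/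
theorem prime_dvd_orbitSum (g : K →* Multiplicative ℤ) {d : ℕ}
    (hd : ∀ k, (fun k => φ k * k⁻¹)^[d] k = 1) {p : ℕ} (hp : p.Prime) (hdp : d + 1 ≤ p) (k : K) :
    (p : ℤ) ∣ Multiplicative.toAdd (orbitSum φ g p k) := by
  set F : ℕ → ℤ := fun l => Multiplicative.toAdd (orbitSum φ g l k) with hF
  have hΔ : fwdDiff 1 F = fun l : ℕ => Multiplicative.toAdd (g ((φ ^ l) k)) := by
    funext l
    simp [fwdDiff, hF, orbitSum, Finset.sum_range_succ]
  -- Newton's formula: F(p) = Σ C(p,j) Δ^j F(0). The term j = 0 vanishes, p divides C(p,j) for 0 < j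
  -- < p, and Δ^p F(0) = 0 by unipotency because p - 1 ≥ d.
  have h := shift_eq_sum_fwdDiff_iter (1 : ℕ) F p 0
  rw [nsmul_one, zero_add, Nat.cast_id] at h
  change (p : ℤ) ∣ F p
  rw [h]
  refine Finset.dvd_sum fun j hj => ?_
  rcases j with _ | j
  · simp [hF, orbitSum]
  · rw [Function.iterate_succ_apply, hΔ, fwdDiff_iter_character]
    rcases (Nat.lt_succ_iff.mp (Finset.mem_range.mp hj)).lt_or_eq with hlt | heq
    · rw [nsmul_eq_mul]
      exact Dvd.dvd.mul_right (Int.natCast_dvd_natCast.mpr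
        (hp.dvd_choose_self j.succ_ne_zero hlt)) _
    · have hjd : j = (j - d) + d := by omega
      rw [hjd, Function.iterate_add_apply, hd, Function.iterate_fixed (by simp)]
      simp

/-- Under a unipotent automorphism of a group with finitely generated abelianization, some element
fixed modulo torsion in the abelianization is detected by an integral character. -/
theorem exists_almost_fixed [Group.FG (Abelianization K)] {d : ℕ}
    (hd : ∀ k, (fun k => φ k * k⁻¹)^[d] k = 1) {x : K}
    (hx : ∀ m : ℕ, m ≠ 0 → x ^ m ∉ commutator K) :
    ∃ (g : K →* Multiplicative ℤ) (k : K) (m : ℕ), g k ≠ 1 ∧ m ≠ 0 ∧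
      (φ k * k⁻¹) ^ m ∈ commutator K := by
  classical
  -- Take the first iterate of x under k ↦ φ(k)k⁻¹ that is torsion in the abelianization; its
  -- predecessor is the required element.
  have hex : ∃ j, ¬ ∀ m : ℕ, m ≠ 0 → ((fun k => φ k * k⁻¹)^[j] x) ^ m ∉ commutator K :=
    ⟨d, fun h => h 1 one_ne_zero (by rw [hd, one_pow]; exact one_mem _)⟩
  have h0 : Nat.find hex ≠ 0 := fun h => Nat.find_spec hex (by rw [h]; exact hx)
  obtain ⟨j, hj⟩ := Nat.exists_eq_succ_of_ne_zero h0
  have hlt := not_not.mp (Nat.find_min hex (m := j) (by omega))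
  have hspec := Nat.find_spec hex
  rw [hj, Function.iterate_succ_apply'] at hspec
  push Not at hspec
  obtain ⟨m, hm, hmem⟩ := hspec
  obtain ⟨g, hg⟩ := exists_character_ne_one hlt
  exact ⟨g, _, m, hg, hm, hmem⟩

end UnipotentAutomorphism

/-! ### Unipotency and finite generation for the kernel -/

section Kernel

variable {Γ : Type*} [Group Γ] (τ : Γ →* Multiplicative ℤ) (t : Γ)

theorem iterate_conjNormal_mem_lowerCentralSeries (j : ℕ) (k : τ.ker) :
    (((fun k => (MulAut.conjNormal t : MulAut τ.ker) k * k⁻¹)^[j] k : τ.ker) : Γ) ∈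
      (⊤ : Subgroup Γ).lowerCentralSeries j := by
  induction j with
  | zero => trivial
  | succ j ih =>
    rw [Function.iterate_succ_apply', Subgroup.coe_mul, MulAut.conjNormal_apply,
      Subgroup.lowerCentralSeries_succ, Subgroup.commutator_comm]
    exact Subgroup.commutator_mem_commutator (Subgroup.mem_top t) ih

theorem exists_iterate_conjNormal_eq_one [Group.IsNilpotent Γ] :
    ∃ d, ∀ k : τ.ker, (fun k => (MulAut.conjNormal t : MulAut τ.ker) k * k⁻¹)^[d] k = 1 := by
  obtain ⟨d, hd⟩ := Subgroup.nilpotent_iff_lowerCentralSeries.mp ‹Group.IsNilpotent Γ›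
  refine ⟨d, fun k => Subtype.ext ?_⟩
  have h := iterate_conjNormal_mem_lowerCentralSeries τ t d k
  rwa [hd, Subgroup.mem_bot] at h

/-- The kernel of a surjection from a finitely generated nilpotent group to `ℤ` has finitely
generated abelianization. -/
theorem fg_abelianization_ker [Group.FG Γ] [Group.IsNilpotent Γ]
    (ht : τ t = Multiplicative.ofAdd 1) : Group.FG (Abelianization τ.ker) := by
  obtain ⟨d, hd⟩ := exists_iterate_conjNormal_eq_one τ t
  obtain ⟨G, hG, hGfin⟩ := Group.fg_iff.mp ‹Group.FG Γ›
  set φ : MulAut τ.ker := MulAut.conjNormal t with hφ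
  set n : τ.ker → τ.ker := fun k => φ k * k⁻¹ with hn
  -- These finitely many iterates should generate K modulo commutators; since `n` vanishes after `d`
  -- steps, `H` contains all the iterates.
  set S : Set τ.ker := Set.image2 (fun j x => n^[j] (kerPart τ t ht x)) (Set.Iio d) G with hS
  have hSfin : S.Finite := Set.Finite.image2 _ (Set.finite_Iio d) hGfin
  set H : Subgroup τ.ker := Subgroup.closure S ⊔ commutator τ.ker with hH
  have hmem : ∀ j, ∀ x ∈ G, n^[j] (kerPart τ t ht x) ∈ H := fun j x hx => by
    by_cases hj : j < d
    · exact le_sup_left (a := Subgroup.closure S) (Subgroup.subset_closure ⟨j, hj, x, hx, rfl⟩)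
    · have hjd : j = (j - d) + d := by omega
      rw [hjd, Function.iterate_add_apply, hd, Function.iterate_fixed (by simp [hn])]
      exact one_mem H
  have hmap : ∀ ψ : MulAut τ.ker, (∀ j, ∀ x ∈ G, ψ (n^[j] (kerPart τ t ht x)) ∈ H) →
      ∀ k ∈ H, ψ k ∈ H := fun ψ hψ => by
    change H ≤ H.comap ψ.toMonoidHom
    refine sup_le ((Subgroup.closure_le _).mpr ?_) ?_
    · rintro _ ⟨j, -, x, hx, rfl⟩
      exact hψ j x hx
    · refine le_trans ?_ (Subgroup.comap_mono le_sup_right)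
      exact (Subgroup.characteristic_iff_le_comap.mp inferInstance) ψ
  have hφH : ∀ k ∈ H, φ k ∈ H := hmap φ fun j x hx => by
    have h := mul_mem (hmem (j + 1) x hx) (hmem j x hx)
    rwa [Function.iterate_succ_apply', hn, inv_mul_cancel_right] at h
  have hφH' : ∀ k ∈ H, φ⁻¹ k ∈ H := hmap φ⁻¹ fun j x hx => by
    -- Descending induction on j from the vanishing iterates, via φ⁻¹(n^j y) = (φ⁻¹(n^(j+1) y))⁻¹ ·
    -- n^j y.
    have key : ∀ e j, d ≤ j + e → φ⁻¹ (n^[j] (kerPart τ t ht x)) ∈ H := fun e => by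
      induction e with
      | zero =>
        intro j hj
        have hjd : j = (j - d) + d := by omega
        rw [hjd, Function.iterate_add_apply, hd, Function.iterate_fixed (by simp [hn]), map_one]
        exact one_mem H
      | succ e ih =>
        intro j hj
        have h := mul_mem (inv_mem (ih (j + 1) (by omega))) (hmem j x hx)
        rw [Function.iterate_succ_apply', hn, map_mul, mul_inv_rev, map_inv, inv_inv,
          MulAut.inv_apply_self, inv_mul_cancel_right] at h
        exact h
    exact key d j (by omega)
  have hpow : ∀ a : ℤ, ∀ k ∈ H, (φ ^ a) k ∈ H := fun a => by
    induction a using Int.induction_on with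
    | zero => exact fun k hk => hk
    | succ a ih => exact fun k hk => by rw [zpow_add_one]; exact ih _ (hφH k hk)
    | pred a ih => exact fun k hk => by rw [zpow_sub_one]; exact ih _ (hφH' k hk)
  -- Stability of `H` under all powers of φ makes `P` a subgroup; it contains the generators of Γ,
  -- so it is Γ, and hence H = K.
  let P : Subgroup Γ :=
    { carrier := {x | kerPart τ t ht x ∈ H}
      one_mem' := by
        have : kerPart τ t ht 1 = 1 := Subtype.ext (by simp [kerPart])
        rw [Set.mem_ofPred_eq, this]
        exact one_mem H
      mul_mem' := fun {x y} hx hy => by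
        rw [Set.mem_ofPred_eq, kerPart_mul]
        exact mul_mem hx (hpow _ _ hy)
      inv_mem' := fun {x} hx => by
        have h := kerPart_mul τ t ht x⁻¹ x
        have h1 : kerPart τ t ht (x⁻¹ * x) = 1 := Subtype.ext (by simp [kerPart])
        rw [h1] at h
        rw [Set.mem_ofPred_eq, ← inv_mem_iff, inv_eq_of_mul_eq_one_right h.symm]
        exact hpow _ _ hx }
  have hP : P = ⊤ := by
    rw [eq_top_iff, ← hG, Subgroup.closure_le]
    exact fun x hx => hmem 0 x hx
  have hHtop : H = ⊤ := by
    refine eq_top_iff.mpr fun k _ => ?_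
    have hk : (k : Γ) ∈ P := hP ▸ Subgroup.mem_top _
    have hk1 : τ k = 1 := k.2
    have : kerPart τ t ht k = k := Subtype.ext (by simp [kerPart, hk1])
    change kerPart τ t ht k ∈ H at hk
    rwa [this] at hk
  refine Group.fg_iff.mpr ⟨Abelianization.of '' S, ?_, hSfin.image _⟩
  rw [← MonoidHom.map_closure]
  have h1 : H.map Abelianization.of = (⊤ : Subgroup τ.ker).map Abelianization.of := by rw [hHtop]
  have h2 : (commutator τ.ker).map Abelianization.of = ⊥ := by
    rw [Subgroup.map_eq_bot_iff, Abelianization.ker_of]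
  rw [hH, Subgroup.map_sup, h2, sup_bot_eq, ← MonoidHom.range_eq_map] at h1
  rw [h1, MonoidHom.range_eq_top]
  exact QuotientGroup.mk_surjective

end Kernel

/-! ### Conclusion -/

theorem mainTheorem1 (Γ : Type*) [Group Γ] (hfg : Group.FG Γ) (hnil : Group.IsNilpotent Γ)
    (htf : ∀ g : Γ, g ≠ 1 → ¬ IsOfFinOrder g) (hnontriv : Nontrivial Γ)
    (hZ : ¬ Nonempty (Γ ≃* Multiplicative ℤ)) :
    ¬ FrobeniusStable Γ := by
  have : Group.FG (Abelianization Γ) := QuotientGroup.fg _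
  obtain ⟨y, hy⟩ := exists_pow_notMem_commutator htf
  obtain ⟨f, hf⟩ := exists_character_ne_one hy
  obtain ⟨τ, t, ht⟩ := exists_character_eq_ofAdd_one hf
  -- A trivial kernel would make τ an isomorphism onto ℤ.
  have hK : Nontrivial τ.ker := by
    rw [Subgroup.nontrivial_iff_ne_bot]
    intro hbot
    refine hZ ⟨MulEquiv.ofBijective τ ⟨(MonoidHom.ker_eq_bot_iff τ).mp hbot, fun a => ?_⟩⟩
    refine ⟨t ^ Multiplicative.toAdd a, ?_⟩
    rw [map_zpow, ht, ← ofAdd_zsmul, smul_eq_mul, mul_one, ofAdd_toAdd]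
  have := fg_abelianization_ker τ t ht
  obtain ⟨x, hx⟩ := exists_pow_notMem_commutator (G := τ.ker) fun k hk hfin =>
    htf k (fun h => hk (Subtype.ext h)) (Submonoid.isOfFinOrder_coe.mpr hfin)
  obtain ⟨d, hd⟩ := exists_iterate_conjNormal_eq_one τ t
  obtain ⟨g, k, m, hgk, hm, hk⟩ := exists_almost_fixed _ hd hx
  exact not_frobeniusStable_of_character τ t g (d + 1)
    (fun p hp hdp => prime_dvd_orbitSum _ g hd hp hdp) hgk hm hk ht
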